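/- A configuration $\omega$ on $\mathbb R$ consists of atoms, finitely many in every bounded interval, each carrying a positive integer multiplicity (point configurations) or a nonzero real charge (charge configurations). $N_\omega(I)$, respectively $Q_\omega(I)$, denotes the number of points, respectively the total charge, in a bounded interval $I$. The configuration spaces carry the $\sigma$-algebra generated by these variables, and $T_x$ is the shift with $Q_{T_x\omega}((a,b])=Q_\omega((a+x,b+x])$ (same for $N$). A probability measure $\mu$ on configurations that is invariant under all $T_x$, $x\in\mathbb R$, is a translation-invariant point process, respectively point-charge process. It has a cyclic factor of period $\lambda\in(0,\infty)$ if there is a measurable function $\varphi$ of $\omega$ with values in $[0,2\pi)$ such that, for a.e. $\omega$, $\varphi(T_x\omega)=\varphi(\omega)-2\pi x/\lambda \pmod{2\pi}$ for all $x\in\mathbb R$. (i) Let $\mu$ be a translation-invariant point process on $\mathbb R$ that is not almost surely empty, and suppose that for some $C<\infty$ the variance of $N((a,b])$ is finite and at most $C$ for all $a<b$. Then $\mu$ has a cyclic factor of period $\lambda=1/\mathbb E(N_{[0,1]})$. (ii) Let $\mu$ be a translation-invariant point-charge process on $\mathbb R$ whose charges are almost surely all integer multiples of some $e\neq0$. Suppose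 that for some $\rho\ne0$ the centred charges $F_\omega(a,b)=Q_\omega((a,b])-\rho(b-a)$, $a<b$, form a tight family: $\mathbb P(|F(a,b)|\ge t)\le p(t)$ for all $a<b$ and all $t$, with $p$ nonincreasing and $p(t)\to0$ as $t\to\infty$. Then $\mu$ has a cyclic factor of period $|e/\rho|$. Moreover, there is a covariant antiderivative, that is, a measurable real function $\mathcal E$ of $\omega$ such that, for a.e. $\omega$, $Q_\omega((a,b])-\rho(b-a)=\mathcal E(T_b\omega)-\mathcal E(T_a\omega)$ for all $a<b$; and for every such $\mathcal E$ the function $\varphi\in[0,2\pi)$ with $\varphi(\omega)=2\pi\,\mathcal E(\omega)/e \pmod{2\pi}$ is measurable and satisfies, for a.e. $\omega$, $\varphi(T_x\omega)=\varphi(\omega)-2\pi x\,\rho/e \pmod{2\pi}$ for all $x\in\mathbb R$. In particular, if $e/\rho>0$, then $\varphi$ itself defines the cyclic factor of period $e/\rho$. -/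

import Mathlib

open MeasureTheory ProbabilityTheory Set Filter Topology

/-- A configuration on the line with locally finitely many atoms: `charge x` is the amount
sitting at the location `x` (zero where there is no atom), and every bounded interval contains
only finitely many atoms.  For `R = ℕ` these are the locally finite particle configurations
(`charge x` is the number of particles at `x`); for `R = ℝ` they are the configurations of
real point charges, i.e. the locally finite purely atomic signed measures whose atoms are
locally finite. -/
@[ext]
structure AtomicConfig (R : Type) [AddCommMonoid R] where
  charge : ℝ → R
  finite_atoms : ∀ a b : ℝ, {x ∈ Icc a b | charge x ≠ 0}.Finite

namespace AtomicConfig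

variable {R : Type} [AddCommMonoid R]

/-- The total charge (or the number of particles) in a bounded set `S`; for bounded `S` this
is a finite sum. -/
noncomputable def total (ω : AtomicConfig R) (S : Set ℝ) : R := ∑ᶠ x ∈ S, ω.charge x

/-- The configuration space carries the σ-algebra generated by the totals in bounded
intervals. -/
noncomputable instance [MeasurableSpace R] : MeasurableSpace (AtomicConfig R) :=
  ⨆ (a : ℝ) (b : ℝ), MeasurableSpace.comap (fun ω : AtomicConfig R => ω.total (Ioc a b))
    inferInstance

/-- The translation `T_x` of configurations: the content of `T_x ω` in `(a, b]` is the content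
of `ω` in `(a + x, b + x]`. -/
def shift (x : ℝ) (ω : AtomicConfig R) : AtomicConfig R where
  charge y := ω.charge (y + x)
  finite_atoms a b := by
    refine ((ω.finite_atoms (a + x) (b + x)).preimage
      (add_left_injective x).injOn).subset ?_
    rintro y ⟨⟨h1, h2⟩, h3⟩
    exact ⟨⟨by linarith, by linarith⟩, h3⟩

/-- The direction of the translation. -/
theorem total_shift (x : ℝ) (ω : AtomicConfig R) (a b : ℝ) :
    (shift x ω).total (Ioc a b) = ω.total (Ioc (a + x) (b + x)) := by
  unfold total shift
  refine finsum_mem_eq_of_bijOn (fun y => y + x) ⟨?_, (add_left_injective x).injOn, ?_⟩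
    (fun _ _ => rfl)
  · rintro y ⟨h1, h2⟩
    exact ⟨by linarith, by linarith⟩
  · rintro y ⟨h1, h2⟩
    exact ⟨y - x, ⟨by linarith, by linarith⟩, by simp⟩

end AtomicConfig

/-- A measure on configurations is translation invariant. -/
def IsTranslationInvariant {R : Type} [AddCommMonoid R] [MeasurableSpace R]
    (μ : Measure (AtomicConfig R)) : Prop :=
  ∀ x : ℝ, MeasurePreserving (AtomicConfig.shift x) μ μ

/-- `φ` is a cyclic function for the flow `T`: it is measurable with values in `[0, 2π)`, and
`φ (T_x ω) = φ ω - 2πx/l (mod 2π)`, where for almost every `ω` this holds for all `x`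
simultaneously.  Here `l ≠ 0` may have either sign. -/
def IsCyclicFunction {Ω : Type*} [MeasurableSpace Ω] (T : ℝ → Ω → Ω) (μ : Measure Ω)
    (l : ℝ) (φ : Ω → ℝ) : Prop :=
  Measurable φ ∧ (∀ ω, φ ω ∈ Ico 0 (2 * Real.pi)) ∧
    ∀ᵐ ω ∂μ, ∀ x : ℝ, (φ (T x ω) : Real.Angle) = ((φ ω - 2 * Real.pi * x / l : ℝ) : Real.Angle)

/-- `μ` has a cyclic factor of period `0 < l < ∞` under the flow `T`. -/
def HasCyclicFactor {Ω : Type*} [MeasurableSpace Ω] (T : ℝ → Ω → Ω) (μ : Measure Ω)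
    (l : ℝ) : Prop :=
  0 < l ∧ ∃ φ : Ω → ℝ, IsCyclicFunction T μ l φ

/-- The family of random variables `F · a b`, `a < b`, is tight: `P(|F(a,b)| ≥ t) ≤ p(t)` with
`p(t) ↘ 0` as `t → ∞`, uniformly in `a < b`. -/
def IsTightFamily {Ω : Type*} [MeasurableSpace Ω] (μ : Measure Ω) (F : Ω → ℝ → ℝ → ℝ) : Prop :=
  ∃ p : ℝ → ENNReal, Antitone p ∧ Tendsto p atTop (𝓝 0) ∧
    ∀ a b : ℝ, a < b → ∀ t : ℝ, μ {ω | t ≤ |F ω a b|} ≤ p t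

/-- The centred charge `Q_ω((a,b]) - ρ (b - a)`. -/
noncomputable def centredCharge (ρ : ℝ) (ω : AtomicConfig ℝ) (a b : ℝ) : ℝ :=
  ω.total (Ioc a b) - ρ * (b - a)

/-- The covariant process `E_ω(x) = E (T_x ω)` is an antiderivative of the field whose integral
over `(a, b]` is `F ω a b`: almost surely `F ω a b = E_ω(b) - E_ω(a)` for all `a < b`. -/
def IsCovariantAntiderivative {Ω : Type*} [MeasurableSpace Ω] (T : ℝ → Ω → Ω) (μ : Measure Ω)
    (F : Ω → ℝ → ℝ → ℝ) (E : Ω → ℝ) : Prop :=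
  Measurable E ∧ ∀ᵐ ω ∂μ, ∀ a b : ℝ, a < b → F ω a b = E (T b ω) - E (T a ω)

/-- The function `2π E / e (mod 2π)`, with values in `[0, 2π)`. -/
noncomputable def phase {Ω : Type*} (e : ℝ) (E : Ω → ℝ) (ω : Ω) : ℝ :=
  toIcoMod Real.two_pi_pos 0 (2 * Real.pi * E ω / e)

/-! The height h, the primitive of ω − ρ vanishing at the origin, has the required increments but is
not covariant: moving the origin to a subtracts h(a) from the whole path (`height_shift`). A level
determined by the long-run behaviour of the path also drops by h(a) under T_a. Such a level is the
median of the time which h spends at different heights over (0, n] as n → ∞, and its negative is the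
antiderivative (`medianHeight_shift`).

The median must be finite. Tightness controls h only at fixed times, and h is not stationary, so a
maximal inequality is needed. The greedy covering `sum_exceedance_le` bounds, along each path, how
many starting points see a large excursion. Averaging over starting points and using translation
invariance bounds the probability of an excursion seen from the origin, uniformly in the window
length (`measure_excursionSet_le`). Almost every path therefore spends at least three quarters of
each window (0, n] in a fixed compact set.

If charges lie in eℤ, the antiderivative changes along a shift by x by an element of eℤ − ρx, so its
phase modulo e rotates at constant speed. For point processes the mean is linear in the length, and
Chebyshev's inequality turns bounded variance into tightness. -/

namespace AtomicConfig

/-! ### Totals and the σ-algebra they generate -/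

section Total

variable {R : Type} [AddCommMonoid R]

theorem finite_support_Ioc (ω : AtomicConfig R) (a b : ℝ) :
    (Ioc a b ∩ Function.support ω.charge).Finite :=
  (ω.finite_atoms a b).subset fun _ hx => ⟨Ioc_subset_Icc_self hx.1, hx.2⟩

theorem total_Ioc_add (ω : AtomicConfig R) {a b c : ℝ} (hab : a ≤ b) (hbc : b ≤ c) :
    ω.total (Ioc a b) + ω.total (Ioc b c) = ω.total (Ioc a c) := by
  unfold total
  rw [← Ioc_union_Ioc_eq_Ioc hab hbc, finsum_mem_union' _ (ω.finite_support_Ioc a b)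
    (ω.finite_support_Ioc b c)]
  exact Set.disjoint_left.2 fun x h1 h2 => absurd h1.2 (not_le.2 h2.1)

theorem total_Ioc_eq_zero (ω : AtomicConfig R) {a b : ℝ} (h : b ≤ a) :
    ω.total (Ioc a b) = 0 := by
  simp [total, Ioc_eq_empty (not_lt.2 h)]

/-- Immediately to the right of any point there are no atoms. -/
theorem exists_total_Ioc_eq_zero (ω : AtomicConfig R) (x : ℝ) :
    ∃ d > 0, ∀ y < x + d, ω.total (Ioc x y) = 0 := by
  have hfin : (Ioc x (x + 1) ∩ Function.support ω.charge).Finite :=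
    ω.finite_support_Ioc x (x + 1)
  have hmem : (Ioc x (x + 1) ∩ Function.support ω.charge)ᶜ ∈ 𝓝 x :=
    hfin.isClosed.isOpen_compl.mem_nhds fun h => lt_irrefl _ h.1.1
  obtain ⟨d, hd, hsub⟩ := Metric.mem_nhds_iff.1 hmem
  refine ⟨min d 1, by positivity, fun y hy => ?_⟩
  unfold total
  refine finsum_mem_eq_zero_of_forall_eq_zero fun z hz => ?_
  by_contra hne
  have h1 : z < x + d := by linarith [hz.2, min_le_left d 1]
  have h2 : z ≤ x + 1 := by linarith [hz.2, min_le_right d 1]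
  have h3 := hz.1
  refine hsub (a := z) ?_ ⟨⟨hz.1, h2⟩, hne⟩
  rw [Metric.mem_ball, Real.dist_eq, abs_lt]
  constructor <;> linarith

theorem shift_zero (ω : AtomicConfig R) : shift 0 ω = ω := by
  ext x
  simp [shift]

theorem measurable_total_Ioc [MeasurableSpace R] (a b : ℝ) :
    Measurable fun ω : AtomicConfig R => ω.total (Ioc a b) := by
  rw [measurable_iff_comap_le]
  exact le_iSup₂_of_le a b le_rfl

theorem measurable_of_total_Ioc [MeasurableSpace R] {Ω : Type*} [MeasurableSpace Ω]
    {f : Ω → AtomicConfig R} (h : ∀ a b, Measurable fun ω => (f ω).total (Ioc a b)) :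
    Measurable f := by
  rw [measurable_iff_comap_le]
  refine MeasurableSpace.comap_le_iff_le_map.2 (iSup₂_le fun a b => ?_)
  rintro s ⟨t, ht, rfl⟩
  exact h a b ht

end Total

/-! ### The height function and its joint measurability -/

/-- The centred height function: the primitive of `ω - ρ` which vanishes at the origin. -/
noncomputable def height (ρ : ℝ) (ω : AtomicConfig ℝ) (x : ℝ) : ℝ :=
  ω.total (Ioc 0 x) - ω.total (Ioc x 0) - ρ * x

theorem height_sub_height (ρ : ℝ) (ω : AtomicConfig ℝ) {a b : ℝ} (hab : a ≤ b) :
    height ρ ω b - height ρ ω a = centredCharge ρ ω a b := by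
  unfold height centredCharge
  rcases le_total 0 a with ha | ha
  · rw [ω.total_Ioc_eq_zero ha, ω.total_Ioc_eq_zero (ha.trans hab), ← ω.total_Ioc_add ha hab]
    ring
  · rcases le_total 0 b with hb | hb
    · rw [ω.total_Ioc_eq_zero ha, ω.total_Ioc_eq_zero hb, ← ω.total_Ioc_add ha hb]
      ring
    · rw [ω.total_Ioc_eq_zero ha, ω.total_Ioc_eq_zero hb, ← ω.total_Ioc_add hab hb]
      ring

theorem height_zero (ρ : ℝ) (ω : AtomicConfig ℝ) : height ρ ω 0 = 0 := by
  simp [height]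

theorem centredCharge_shift (ρ x : ℝ) (ω : AtomicConfig ℝ) (a b : ℝ) :
    centredCharge ρ (shift x ω) a b = centredCharge ρ ω (a + x) (b + x) := by
  unfold centredCharge
  rw [total_shift]
  ring

theorem height_shift (ρ a : ℝ) (ω : AtomicConfig ℝ) (x : ℝ) :
    height ρ (shift a ω) x = height ρ ω (x + a) - height ρ ω a := by
  rcases le_total 0 x with hx | hx
  · have h1 := height_sub_height ρ (shift a ω) hx
    rw [centredCharge_shift, height_zero,
      ← height_sub_height ρ ω (by linarith : 0 + a ≤ x + a), zero_add] at h1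
    linarith
  · have h1 := height_sub_height ρ (shift a ω) hx
    rw [centredCharge_shift, height_zero,
      ← height_sub_height ρ ω (by linarith : x + a ≤ 0 + a), zero_add] at h1
    linarith

theorem measurable_height (ρ x : ℝ) : Measurable fun ω => height ρ ω x :=
  ((measurable_total_Ioc 0 x).sub (measurable_total_Ioc x 0)).sub_const _

theorem tendsto_height (ρ : ℝ) (ω : AtomicConfig ℝ) (x : ℝ) :
    Tendsto (height ρ ω) (𝓝[≥] x) (𝓝 (height ρ ω x)) := by
  obtain ⟨d, hd, h⟩ := ω.exists_total_Ioc_eq_zero x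
  have h1 : Tendsto (fun y => height ρ ω x - ρ * (y - x)) (𝓝[≥] x) (𝓝 (height ρ ω x)) := by
    have : Continuous fun y => height ρ ω x - ρ * (y - x) := by fun_prop
    simpa [ContinuousWithinAt] using this.continuousWithinAt (x := x) (s := Ici x)
  refine h1.congr' ?_
  filter_upwards [self_mem_nhdsWithin,
    mem_nhdsWithin_of_mem_nhds (Iio_mem_nhds (by linarith : x < x + d))] with y hy hyd
  have := height_sub_height ρ ω hy
  rw [centredCharge, h y hyd] at this
  linarith

/-- Right-continuity makes the height a limit of its values at grid points approaching x from the
right, and each approximation uses only countably many times. This allows Fubini and measurable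
sojourn times. -/
theorem measurable_uncurry_height (ρ : ℝ) :
    Measurable fun p : AtomicConfig ℝ × ℝ => height ρ p.1 p.2 := by
  have hlim : ∀ x : ℝ, Tendsto (fun n : ℕ => ((⌊((n : ℝ) + 1) * x⌋ : ℝ) + 1) / ((n : ℝ) + 1))
      atTop (𝓝[≥] x) := by
    intro x
    refine tendsto_nhdsWithin_iff.2 ⟨?_, Eventually.of_forall fun n => ?_⟩
    · have h1 : Tendsto (fun n : ℕ => x + 1 / ((n : ℝ) + 1)) atTop (𝓝 x) := by
        simpa using tendsto_const_nhds.add (tendsto_one_div_add_atTop_nhds_zero_nat (𝕜 := ℝ))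
      refine tendsto_of_tendsto_of_tendsto_of_le_of_le tendsto_const_nhds h1 ?_ ?_
      · intro n
        have hn : (0 : ℝ) < (n : ℝ) + 1 := by positivity
        simp only
        rw [le_div_iff₀ hn]
        linarith [Int.lt_floor_add_one (((n : ℝ) + 1) * x)]
      · intro n
        have hn : (0 : ℝ) < (n : ℝ) + 1 := by positivity
        simp only
        rw [div_le_iff₀ hn, add_mul x, one_div_mul_cancel hn.ne']
        linarith [Int.floor_le (((n : ℝ) + 1) * x)]
    · have hn : (0 : ℝ) < (n : ℝ) + 1 := by positivity
      rw [mem_Ici, le_div_iff₀ hn]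
      linarith [Int.lt_floor_add_one (((n : ℝ) + 1) * x)]
  refine measurable_of_tendsto_metrizable (f := fun (n : ℕ) (p : AtomicConfig ℝ × ℝ) =>
    height ρ p.1 (((⌊((n : ℝ) + 1) * p.2⌋ : ℝ) + 1) / ((n : ℝ) + 1))) (fun n => ?_) ?_
  · have h2 : Measurable fun p : AtomicConfig ℝ × ℝ => (p.1, ⌊((n : ℝ) + 1) * p.2⌋) :=
      measurable_fst.prodMk (measurable_snd.const_mul _).floor
    have h1 : ∀ y : ℤ → ℝ, Measurable fun p : AtomicConfig ℝ × ℤ => height ρ p.1 (y p.2) :=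
      fun y => measurable_from_prod_countable_left fun k => measurable_height ρ (y k)
    have h3 := (h1 fun k => ((k : ℝ) + 1) / ((n : ℝ) + 1)).comp h2
    simpa only [Function.comp_def] using h3
  · exact tendsto_pi_nhds.2 fun p => (tendsto_height ρ p.1 p.2).comp (hlim p.2)

end AtomicConfig

/-! ### A discrete maximal inequality -/

/-- A greedy covering bound: the starting points of intervals of integers on which the average
of `b` exceeds `1 / c` are controlled by the sum of `b`. -/
theorem sum_exceedance_le (b : ℕ → ENNReal) (c : ENNReal) (N d i : ℕ) (hd : i + d = N) :
    (∑ j ∈ Finset.Ico i N, {j : ℕ | ∃ n, 0 < n ∧ j + n ≤ N ∧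
      (n : ENNReal) < c * ∑ k ∈ Finset.Ico j (j + n), b k}.indicator (1 : ℕ → ENNReal) j) ≤
      c * ∑ k ∈ Finset.Ico i N, b k := by
  induction d using Nat.strong_induction_on generalizing i with
  | _ d ih =>
  by_cases hi : ∃ n, 0 < n ∧ i + n ≤ N ∧ (n : ENNReal) < c * ∑ k ∈ Finset.Ico i (i + n), b k
  · obtain ⟨n, hn, hnN, hlt⟩ := hi
    rw [← Finset.sum_Ico_consecutive _ (Nat.le_add_right i n) hnN,
      ← Finset.sum_Ico_consecutive b (Nat.le_add_right i n) hnN, mul_add]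
    -- The n starts in the block count at most n, which the block's own sum pays for; the induction
    -- resumes after the block.
    refine add_le_add (le_trans ?_ hlt.le) (ih (d - n) (by omega) (i + n) (by omega))
    refine (Finset.sum_le_card_nsmul _ _ 1 fun j _ => ?_).trans (by simp)
    exact Set.indicator_le_self' (by simp) j
  · rcases Nat.eq_zero_or_pos d with rfl | hpos
    · simp [← hd]
    · have hiN : i < N := by omega
      rw [Finset.sum_eq_sum_Ico_succ_bot hiN, Finset.sum_eq_sum_Ico_succ_bot hiN b,
        Set.indicator_of_notMem (by exact hi), zero_add]
      exact (ih (d - 1) (by omega) (i + 1) (by omega)).trans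
        (mul_le_mul_right (le_add_self) _)

/-! ### Sojourn times and the median level -/

namespace AtomicConfig

/-- The time in `(0, n]` which the height function spends in `s`. -/
noncomputable def sojourn (ρ : ℝ) (ω : AtomicConfig ℝ) (n : ℕ) (s : Set ℝ) : ENNReal :=
  volume (Ioc (0 : ℝ) n ∩ height ρ ω ⁻¹' s)

theorem measurable_height_apply (ρ : ℝ) (ω : AtomicConfig ℝ) : Measurable (height ρ ω) :=
  (measurable_uncurry_height ρ).comp measurable_prodMk_left

theorem sojourn_mono (ρ : ℝ) (ω : AtomicConfig ℝ) (n : ℕ) {s t : Set ℝ} (h : s ⊆ t) :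
    sojourn ρ ω n s ≤ sojourn ρ ω n t :=
  measure_mono (inter_subset_inter_right _ (preimage_mono h))

theorem measurable_sojourn (ρ : ℝ) (n : ℕ) {s : Set ℝ} (hs : MeasurableSet s) :
    Measurable fun ω => sojourn ρ ω n s := by
  have h : MeasurableSet {p : AtomicConfig ℝ × ℝ | p.2 ∈ Ioc (0 : ℝ) n ∧ height ρ p.1 p.2 ∈ s} :=
    (measurable_snd measurableSet_Ioc).inter (measurable_uncurry_height ρ hs)
  exact measurable_measure_prodMk_left (ν := (volume : Measure ℝ)) h

/-- The shifted window (a, n + a] exceeds (0, n] by a set of length at most |a|. -/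
theorem sojourn_shift_le (ρ a : ℝ) (ω : AtomicConfig ℝ) (n : ℕ) (q : ℝ) :
    sojourn ρ (shift a ω) n (Iic q) ≤
      sojourn ρ ω n (Iic (q + height ρ ω a)) + ENNReal.ofReal |a| := by
  have h1 : Ioc (0 : ℝ) n ∩ height ρ (shift a ω) ⁻¹' Iic q =
      (fun x => x + a) ⁻¹' (Ioc a (n + a) ∩ height ρ ω ⁻¹' Iic (q + height ρ ω a)) := by
    ext x
    simp only [mem_inter_iff, mem_Ioc, mem_preimage, mem_Iic, height_shift]
    constructor <;> rintro ⟨⟨h1, h2⟩, h3⟩ <;> refine ⟨⟨?_, ?_⟩, ?_⟩ <;> linarith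
  have h2 : Ioc a (n + a) ∩ height ρ ω ⁻¹' Iic (q + height ρ ω a) ⊆
      (Ioc (0 : ℝ) n ∩ height ρ ω ⁻¹' Iic (q + height ρ ω a)) ∪
        (Ioc a 0 ∪ Ioc (n : ℝ) (n + a)) := by
    rintro x ⟨⟨h1, h2⟩, h3⟩
    rcases le_or_gt x 0 with h0 | h0
    · exact Or.inr (Or.inl ⟨h1, h0⟩)
    · rcases le_or_gt x n with hn | hn
      · exact Or.inl ⟨⟨h0, hn⟩, h3⟩
      · exact Or.inr (Or.inr ⟨hn, h2⟩)
  unfold sojourn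
  rw [h1, measure_preimage_add_right]
  refine (measure_mono h2).trans ((measure_union_le _ _).trans (add_le_add le_rfl ?_))
  refine (measure_union_le _ _).trans ?_
  rw [Real.volume_Ioc, Real.volume_Ioc]
  rcases le_total 0 a with h | h
  · rw [ENNReal.ofReal_of_nonpos (by linarith), abs_of_nonneg h]
    simp
  · rw [ENNReal.ofReal_of_nonpos (p := (n : ℝ) + a - n) (by linarith), abs_of_nonpos h]
    simp

/-- The levels below which the height function spends asymptotically at least half of its time,
along some sequence of times. -/
def halfLevels (ρ : ℝ) (ω : AtomicConfig ℝ) : Set ℝ :=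
  {q | ∃ C : ℕ, ∃ᶠ n : ℕ in atTop, (n : ENNReal) ≤ 2 * sojourn ρ ω n (Iic q) + C}

theorem mem_halfLevels_of_le {ρ : ℝ} {ω : AtomicConfig ℝ} {q r : ℝ} (hq : q ∈ halfLevels ρ ω)
    (h : q ≤ r) : r ∈ halfLevels ρ ω := by
  obtain ⟨C, hC⟩ := hq
  refine ⟨C, hC.mono fun n hn => hn.trans ?_⟩
  gcongr
  exact sojourn_mono ρ ω n (Iic_subset_Iic.2 h)

/-- The boundary error 2|a| is absorbed by the additive constant allowed in `halfLevels`, which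
makes the covariance exact. -/
theorem add_mem_halfLevels {ρ a : ℝ} {ω : AtomicConfig ℝ} {q : ℝ}
    (hq : q ∈ halfLevels ρ (shift a ω)) : q + height ρ ω a ∈ halfLevels ρ ω := by
  obtain ⟨C, hC⟩ := hq
  refine ⟨2 * ⌈|a|⌉₊ + C, hC.mono fun n hn => hn.trans ?_⟩
  push_cast
  rw [← add_assoc, ← mul_add]
  gcongr
  refine (sojourn_shift_le ρ a ω n q).trans ?_
  gcongr
  rw [← ENNReal.ofReal_natCast]
  exact ENNReal.ofReal_le_ofReal (Nat.le_ceil _)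

theorem shift_shift (a b : ℝ) (ω : AtomicConfig ℝ) : shift a (shift b ω) = shift (a + b) ω := by
  ext x
  simp [shift, add_assoc]

theorem halfLevels_shift (ρ a : ℝ) (ω : AtomicConfig ℝ) :
    halfLevels ρ (shift a ω) = (fun q => q - height ρ ω a) '' halfLevels ρ ω := by
  ext q
  constructor
  · exact fun h => ⟨_, add_mem_halfLevels h, by ring⟩
  · rintro ⟨r, hr, rfl⟩
    have h1 : shift (-a) (shift a ω) = ω := by
      rw [shift_shift, neg_add_cancel, shift_zero]
    rw [← h1] at hr
    have h2 := add_mem_halfLevels hr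
    rwa [height_shift, neg_add_cancel, height_zero, zero_sub] at h2

/-- The level which splits the time spent by the height function into halves. -/
noncomputable def medianHeight (ρ : ℝ) (ω : AtomicConfig ℝ) : ℝ := sInf (halfLevels ρ ω)

theorem medianHeight_shift {ρ : ℝ} {ω : AtomicConfig ℝ} (hne : (halfLevels ρ ω).Nonempty)
    (hbdd : BddBelow (halfLevels ρ ω)) (a : ℝ) :
    medianHeight ρ (shift a ω) = medianHeight ρ ω - height ρ ω a := by
  rw [medianHeight, halfLevels_shift, medianHeight]
  have := (OrderIso.addRight (-height ρ ω a)).map_csInf' hne hbdd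
  simpa [sub_eq_add_neg] using this.symm

theorem measurableSet_mem_halfLevels (ρ q : ℝ) : MeasurableSet {ω | q ∈ halfLevels ρ ω} := by
  have h : {ω | q ∈ halfLevels ρ ω} = ⋃ C : ℕ, ⋂ m : ℕ, ⋃ n : ℕ, {_ω | m ≤ n} ∩
      {ω | (n : ENNReal) ≤ 2 * sojourn ρ ω n (Iic q) + C} := by
    ext ω
    simp [halfLevels, frequently_atTop]
  rw [h]
  refine MeasurableSet.iUnion fun C => MeasurableSet.iInter fun m => MeasurableSet.iUnion fun n =>
    (MeasurableSet.const _).inter ?_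
  exact measurableSet_le measurable_const
    (((measurable_sojourn ρ n measurableSet_Iic).const_mul 2).add_const _)

theorem measurable_medianHeight (ρ : ℝ) : Measurable (medianHeight ρ) := by
  refine measurable_of_Iio fun c => ?_
  have hne : ∀ ω, (halfLevels ρ ω).Nonempty ↔ ∃ n : ℕ, (n : ℝ) ∈ halfLevels ρ ω := fun ω =>
    ⟨fun ⟨q, hq⟩ => (exists_nat_ge q).imp fun n hn => mem_halfLevels_of_le hq hn,
      fun ⟨n, hn⟩ => ⟨n, hn⟩⟩
  have hbdd : ∀ ω, BddBelow (halfLevels ρ ω) ↔ ∃ n : ℕ, (-n : ℝ) ∉ halfLevels ρ ω := by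
    refine fun ω => ⟨fun ⟨q, hq⟩ => ?_, fun ⟨n, hn⟩ => ⟨-n, fun q hq => ?_⟩⟩
    · obtain ⟨n, hn⟩ := exists_nat_gt (-q)
      exact ⟨n, fun h => by linarith [hq h]⟩
    · by_contra! h
      exact hn (mem_halfLevels_of_le hq h.le)
  have hlt : ∀ ω, (halfLevels ρ ω).Nonempty ∧ BddBelow (halfLevels ρ ω) →
      (medianHeight ρ ω < c ↔ ∃ q : ℚ, (q : ℝ) < c ∧ (q : ℝ) ∈ halfLevels ρ ω) := by
    rintro ω ⟨h1, h2⟩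
    rw [medianHeight, csInf_lt_iff h2 h1]
    constructor
    · rintro ⟨r, hr, hrc⟩
      obtain ⟨q, hq1, hq2⟩ := exists_rat_btwn hrc
      exact ⟨q, hq2, mem_halfLevels_of_le hr hq1.le⟩
    · rintro ⟨q, hq, h⟩
      exact ⟨q, h, hq⟩
  -- Where the infimum is not genuine, `sInf` takes the default value 0; this case is split off
  -- measurably.
  have hjunk : ∀ ω, ¬((halfLevels ρ ω).Nonempty ∧ BddBelow (halfLevels ρ ω)) →
      medianHeight ρ ω = 0 := by
    intro ω h
    rcases (halfLevels ρ ω).eq_empty_or_nonempty with h0 | h0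
    · rw [medianHeight, h0, Real.sInf_empty]
    · exact Real.sInf_of_not_bddBelow fun h1 => h ⟨h0, h1⟩
  let A : Set (AtomicConfig ℝ) := {ω | (halfLevels ρ ω).Nonempty ∧ BddBelow (halfLevels ρ ω)}
  have hA : MeasurableSet A := by
    simp only [A, hne, hbdd, ofPred_and, ofPred_exists]
    exact (MeasurableSet.iUnion fun n => measurableSet_mem_halfLevels ρ _).inter
      (MeasurableSet.iUnion fun n => (measurableSet_mem_halfLevels ρ _).compl)
  have heq : medianHeight ρ ⁻¹' Iio c =
      (A ∩ ⋃ q : ℚ, {ω | (q : ℝ) < c} ∩ {ω | (q : ℝ) ∈ halfLevels ρ ω}) ∪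
        (Aᶜ ∩ {ω | (0 : ℝ) < c}) := by
    ext ω
    by_cases h : ω ∈ A
    · simp only [mem_preimage, mem_Iio, hlt ω h, mem_union, mem_inter_iff, h, mem_iUnion,
        mem_ofPred_eq, mem_compl_iff, not_true, true_and, false_and, or_false]
    · simp only [mem_preimage, mem_Iio, hjunk ω h, mem_union, mem_inter_iff, h,
        mem_ofPred_eq, mem_compl_iff, not_false_eq_true, true_and, false_and, false_or]
  rw [heq]
  exact (hA.inter (MeasurableSet.iUnion fun q => (MeasurableSet.const _).inter
    (measurableSet_mem_halfLevels ρ _))).union (hA.compl.inter (MeasurableSet.const _))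

theorem sojourn_ne_top (ρ : ℝ) (ω : AtomicConfig ℝ) (n : ℕ) (s : Set ℝ) :
    sojourn ρ ω n s ≠ ⊤ :=
  ((measure_mono inter_subset_left).trans_lt measure_Ioc_lt_top).ne

/-- A level below −t is undershot for at most n/4, so n ≤ n/2 + C would hold for arbitrarily large
n. -/
theorem bddBelow_halfLevels {ρ t : ℝ} {ω : AtomicConfig ℝ}
    (h : ∀ n : ℕ, 4 * sojourn ρ ω n {y | t < |y|} ≤ n) : BddBelow (halfLevels ρ ω) := by
  refine ⟨-t, fun q hq => ?_⟩
  by_contra! hlt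
  obtain ⟨C, hC⟩ := hq
  obtain ⟨n, hn, hnC⟩ := (frequently_atTop.1 hC) (2 * C + 1)
  have h1 : sojourn ρ ω n (Iic q) ≤ sojourn ρ ω n {y | t < |y|} :=
    sojourn_mono ρ ω n fun y (hy : y ≤ q) => lt_of_lt_of_le (by linarith) (neg_le_abs y)
  have h2 : (2 * n : ENNReal) ≤ n + 2 * C :=
    calc (2 * n : ENNReal) ≤ 2 * (2 * sojourn ρ ω n (Iic q) + C) := by gcongr
      _ = 4 * sojourn ρ ω n (Iic q) + 2 * C := by ring
      _ ≤ 4 * sojourn ρ ω n {y | t < |y|} + 2 * C := by gcongr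
      _ ≤ n + 2 * C := by gcongr; exact h n
  have h3 : 2 * n ≤ n + 2 * C := by exact_mod_cast h2
  omega

/-- The path is at or below t for at least three quarters of each window, so t is a half level with
C = 0. -/
theorem nonempty_halfLevels {ρ t : ℝ} {ω : AtomicConfig ℝ}
    (h : ∀ n : ℕ, 4 * sojourn ρ ω n {y | t < |y|} ≤ n) : (halfLevels ρ ω).Nonempty := by
  refine ⟨t, 0, Eventually.frequently (Eventually.of_forall fun n => ?_)⟩
  have h1 : (n : ENNReal) ≤ sojourn ρ ω n (Iic t) + sojourn ρ ω n {y | t < |y|} := by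
    calc (n : ENNReal) = volume (Ioc (0 : ℝ) n) := by simp
      _ ≤ _ := measure_mono fun x hx => ?_
      _ ≤ _ := measure_union_le _ _
    rcases le_or_gt (height ρ ω x) t with h2 | h2
    · exact Or.inl ⟨hx, h2⟩
    · exact Or.inr ⟨hx, h2.trans_le (le_abs_self _)⟩
  have h2 := h n
  lift sojourn ρ ω n (Iic t) to NNReal using sojourn_ne_top _ _ _ _ with x
  lift sojourn ρ ω n {y | t < |y|} to NNReal using sojourn_ne_top _ _ _ _ with y
  have h1' : (n : NNReal) ≤ x + y := by exact_mod_cast h1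
  have h2' : 4 * y ≤ (n : NNReal) := by exact_mod_cast h2
  have : (n : NNReal) ≤ 2 * x := by
    rw [← NNReal.coe_le_coe] at *
    push_cast at *
    have := x.2
    linarith [y.2]
  simpa using (by exact_mod_cast this : (n : ENNReal) ≤ 2 * x)

end AtomicConfig

/-! ### Excursions of the height under tightness -/

namespace AtomicConfig

/-- Some initial interval `(0, n]`, `n ≤ K`, has more than a quarter of its length spent by the
height function outside `[-t, t]`. -/
def excursionSet (ρ t : ℝ) (K : ℕ) : Set (AtomicConfig ℝ) :=
  {ω | ∃ n : ℕ, 0 < n ∧ n ≤ K ∧ (n : ENNReal) < 4 * sojourn ρ ω n {y | t < |y|}}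

theorem measurableSet_lt_abs (t : ℝ) : MeasurableSet {y : ℝ | t < |y|} :=
  measurableSet_lt measurable_const continuous_abs.measurable

theorem measurableSet_excursionSet (ρ t : ℝ) (K : ℕ) : MeasurableSet (excursionSet ρ t K) := by
  have h : excursionSet ρ t K = ⋃ n : ℕ, {_ω | 0 < n ∧ n ≤ K} ∩
      {ω | (n : ENNReal) < 4 * sojourn ρ ω n {y | t < |y|}} := by
    ext ω
    simp [excursionSet, and_assoc]
  rw [h]
  exact MeasurableSet.iUnion fun n => (MeasurableSet.const _).inter
    (measurableSet_lt measurable_const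
      ((measurable_sojourn ρ n (measurableSet_lt_abs t)).const_mul 4))

theorem sum_volume_unit_intervals {A : Set ℝ} (hA : MeasurableSet A) (j n : ℕ) :
    ∑ k ∈ Finset.Ico j (j + n), volume (Ioc (k : ℝ) (k + 1) ∩ A) =
      volume (Ioc (j : ℝ) (j + n) ∩ A) := by
  induction n with
  | zero => simp
  | succ n ih =>
    rw [← add_assoc, Finset.sum_Ico_succ_top (by omega), ih, ← measure_union
      (Set.disjoint_left.2 fun x h1 h2 => ?_) (measurableSet_Ioc.inter hA),
      ← union_inter_distrib_right]
    · push_cast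
      rw [Ioc_union_Ioc_eq_Ioc (by simp) (by simp), add_assoc]
    · have := h1.1.2
      have h3 := h2.1.1
      push_cast at h3
      linarith

theorem sojourn_shift_abs_le {ρ t : ℝ} {ω : AtomicConfig ℝ} {j : ℕ} (n : ℕ)
    (hj : |height ρ ω j| ≤ t) :
    sojourn ρ (shift j ω) n {y | 2 * t < |y|} ≤
      volume (Ioc (j : ℝ) (j + n) ∩ height ρ ω ⁻¹' {y | t < |y|}) := by
  rw [← measure_preimage_add_right (μ := (volume : Measure ℝ)) (j : ℝ)
    (Ioc (j : ℝ) (j + n) ∩ height ρ ω ⁻¹' {y | t < |y|})]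
  refine measure_mono ?_
  rintro x ⟨hx, h⟩
  refine ⟨⟨by linarith [hx.1], by linarith [hx.2]⟩, ?_⟩
  have h : 2 * t < |height ρ (shift j ω) x| := h
  rw [height_shift] at h
  have := abs_sub (height ρ ω (x + j)) (height ρ ω j)
  show t < |height ρ ω (x + j)|
  linarith

/-- If the path rebased at j makes an excursion beyond 2t, then either |h(j)| > t, or the original
path makes one beyond t after j. Starts of the first kind are counted directly, those of the second
by the greedy covering. -/
theorem sum_indicator_excursionSet_le (ρ t : ℝ) (K : ℕ) (ω : AtomicConfig ℝ) :
    ∑ j ∈ Finset.range K, (excursionSet ρ (2 * t) K).indicator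
        (1 : AtomicConfig ℝ → ENNReal) (shift j ω) ≤
      ∑ j ∈ Finset.range K, {ω | t < |height ρ ω j|}.indicator (1 : AtomicConfig ℝ → ENNReal) ω +
        4 * sojourn ρ ω (2 * K) {y | t < |y|} := by
  have hA : MeasurableSet (height ρ ω ⁻¹' {y | t < |y|}) :=
    measurable_height_apply ρ ω (measurableSet_lt_abs t)
  let b : ℕ → ENNReal := fun k => volume (Ioc (k : ℝ) (k + 1) ∩ height ρ ω ⁻¹' {y | t < |y|})
  -- Windows of length at most K starting at j < K stay inside (0, 2K].
  let B : Set ℕ := {j : ℕ | ∃ n, 0 < n ∧ j + n ≤ 2 * K ∧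
      (n : ENNReal) < 4 * ∑ k ∈ Finset.Ico j (j + n), b k}
  have h1 : ∑ j ∈ Finset.range K, B.indicator (1 : ℕ → ENNReal) j ≤
      4 * sojourn ρ ω (2 * K) {y | t < |y|} := by
    have h2 := sum_exceedance_le b 4 (2 * K) (2 * K) 0 (by omega)
    have h3 := sum_volume_unit_intervals hA 0 (2 * K)
    rw [zero_add] at h3
    rw [h3, Nat.Ico_zero_eq_range] at h2
    have h4 : ∑ j ∈ Finset.range K, B.indicator (1 : ℕ → ENNReal) j ≤
        ∑ j ∈ Finset.range (2 * K), B.indicator (1 : ℕ → ENNReal) j :=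
      Finset.sum_le_sum_of_subset (Finset.range_mono (by omega))
    simpa [sojourn] using h4.trans h2
  refine le_trans ?_ (add_le_add le_rfl h1)
  rw [← Finset.sum_add_distrib]
  refine Finset.sum_le_sum fun j hj => ?_
  rw [Finset.mem_range] at hj
  by_cases hG : shift j ω ∈ excursionSet ρ (2 * t) K
  · rw [indicator_of_mem hG]
    rcases le_or_gt |height ρ ω j| t with h | h
    · obtain ⟨n, hn, hnK, hlt⟩ := hG
      have : j ∈ B := by
        refine ⟨n, hn, by omega, hlt.trans_le ?_⟩
        rw [sum_volume_unit_intervals hA]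
        gcongr
        exact sojourn_shift_abs_le n h
      rw [indicator_of_mem this]
      exact le_add_self
    · rw [indicator_of_mem (show ω ∈ {ω | t < |height ρ ω j|} from h)]
      exact le_self_add
  · rw [indicator_of_notMem hG]
    exact zero_le

theorem lintegral_sojourn_le {μ : Measure (AtomicConfig ℝ)} [IsProbabilityMeasure μ] {ρ : ℝ}
    {c : ENNReal} {s : Set ℝ} (hs : MeasurableSet s)
    (h : ∀ x : ℝ, 0 < x → μ {ω | height ρ ω x ∈ s} ≤ c) (n : ℕ) :
    ∫⁻ ω, sojourn ρ ω n s ∂μ ≤ n * c := by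
  have hm : MeasurableSet {p : AtomicConfig ℝ × ℝ | height ρ p.1 p.2 ∈ s} :=
    measurable_uncurry_height ρ hs
  have h1 : ∫⁻ ω, sojourn ρ ω n s ∂μ = (μ.prod (volume.restrict (Ioc (0 : ℝ) n)))
      {p : AtomicConfig ℝ × ℝ | height ρ p.1 p.2 ∈ s} := by
    rw [Measure.prod_apply hm]
    refine lintegral_congr fun ω => ?_
    rw [sojourn, Measure.restrict_apply (measurable_prodMk_left hm), inter_comm]
    rfl
  rw [h1, Measure.prod_apply_symm hm]
  calc ∫⁻ x in Ioc (0 : ℝ) n, μ ((fun ω => (ω, x)) ⁻¹' {p | height ρ p.1 p.2 ∈ s})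
      ≤ ∫⁻ _x in Ioc (0 : ℝ) n, c := setLIntegral_mono measurable_const fun x hx => h x hx.1
    _ = n * c := by simp [mul_comm]

/-- All K starts have the same probability by invariance. After dividing by K, the starts with
|h(j)| > t contribute c, and the time beyond t in (0, 2K] contributes 4 · 2c. -/
theorem measure_excursionSet_le {μ : Measure (AtomicConfig ℝ)} [IsProbabilityMeasure μ]
    (hμ : IsTranslationInvariant μ) {ρ t : ℝ} {c : ENNReal} (ht : 0 ≤ t)
    (h : ∀ x : ℝ, 0 < x → μ {ω | t < |height ρ ω x|} ≤ c) {K : ℕ} (hK : 0 < K) :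
    μ (excursionSet ρ (2 * t) K) ≤ 9 * c := by
  have hG := measurableSet_excursionSet ρ (2 * t) K
  have h0 : ∀ x : ℝ, 0 ≤ x → μ {ω | t < |height ρ ω x|} ≤ c := by
    intro x hx
    rcases hx.eq_or_lt with rfl | hx
    · simp [height_zero, not_lt.2 ht]
    · exact h x hx
  have hm : ∀ j : ℕ, MeasurableSet {ω | t < |height ρ ω j|} := fun j =>
    measurable_height ρ j (measurableSet_lt_abs t)
  have hT : ∀ j : ℕ, Measurable fun ω : AtomicConfig ℝ =>
      (excursionSet ρ (2 * t) K).indicator (1 : AtomicConfig ℝ → ENNReal) (shift j ω) := fun j =>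
    (measurable_one.indicator hG).comp (hμ j).measurable
  have h1 : (K : ENNReal) * μ (excursionSet ρ (2 * t) K) ≤ K * (9 * c) := by
    calc (K : ENNReal) * μ (excursionSet ρ (2 * t) K)
        = ∑ j ∈ Finset.range K, ∫⁻ ω, (excursionSet ρ (2 * t) K).indicator
            (1 : AtomicConfig ℝ → ENNReal) (shift j ω) ∂μ := by
          have hj : ∀ j : ℕ, ∫⁻ ω, (excursionSet ρ (2 * t) K).indicator
              (1 : AtomicConfig ℝ → ENNReal) (shift j ω) ∂μ = μ (excursionSet ρ (2 * t) K) :=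
            fun j => ((hμ j).lintegral_comp (measurable_one.indicator hG)).trans
              (lintegral_indicator_one hG)
          simp [hj]
      _ = ∫⁻ ω, ∑ j ∈ Finset.range K, (excursionSet ρ (2 * t) K).indicator
            (1 : AtomicConfig ℝ → ENNReal) (shift j ω) ∂μ :=
          (lintegral_finsetSum _ fun j _ => hT j).symm
      _ ≤ ∫⁻ ω, (∑ j ∈ Finset.range K, {ω | t < |height ρ ω j|}.indicator
            (1 : AtomicConfig ℝ → ENNReal) ω + 4 * sojourn ρ ω (2 * K) {y | t < |y|}) ∂μ :=
          lintegral_mono (sum_indicator_excursionSet_le ρ t K)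
      _ = ∑ j ∈ Finset.range K, μ {ω | t < |height ρ ω j|} +
            4 * ∫⁻ ω, sojourn ρ ω (2 * K) {y | t < |y|} ∂μ := by
          rw [lintegral_add_left
              (Finset.measurable_sum _ fun j _ => measurable_one.indicator (hm j)),
            lintegral_finsetSum _ fun j _ => measurable_one.indicator (hm j),
            lintegral_const_mul _ (measurable_sojourn ρ _ (measurableSet_lt_abs t))]
          simp_rw [fun j : ℕ => lintegral_indicator_one (μ := μ) (hm j)]
      _ ≤ ∑ _j ∈ Finset.range K, c + 4 * ((2 * K : ℕ) * c) := by
          gcongr with j hj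
          · exact h0 j (Nat.cast_nonneg j)
          · exact lintegral_sojourn_le (measurableSet_lt_abs t) h _
      _ = K * (9 * c) := by
          simp only [Finset.sum_const, Finset.card_range, nsmul_eq_mul]
          push_cast
          ring
  exact (ENNReal.mul_le_mul_iff_right (by simpa using hK.ne') (by simp)).1 h1

/-- For a tight family of centred charges, the height function almost surely spends most of
its time in a compact set. -/
theorem ae_exists_sojourn_le {μ : Measure (AtomicConfig ℝ)} [IsProbabilityMeasure μ]
    (hμ : IsTranslationInvariant μ) {ρ : ℝ} (htight : IsTightFamily μ (centredCharge ρ)) :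
    ∀ᵐ ω ∂μ, ∃ t : ℝ, ∀ n : ℕ, 4 * sojourn ρ ω n {y | t < |y|} ≤ n := by
  obtain ⟨p, -, hp0, hp⟩ := htight
  have h1 : ∀ t : ℝ, 0 ≤ t → ∀ x : ℝ, 0 < x → μ {ω | t < |height ρ ω x|} ≤ p t := by
    intro t _ x hx
    refine (measure_mono fun ω (hω : t < _) => ?_).trans (hp 0 x hx t)
    have := height_sub_height ρ ω hx.le
    rw [height_zero, sub_zero] at this
    show t ≤ |centredCharge ρ ω 0 x|
    rw [← this]
    exact hω.le
  have h2 : ∀ t : ℕ, μ (⋃ K : ℕ, excursionSet ρ (2 * t) K) ≤ 9 * p t := by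
    intro t
    have hmono : Monotone fun K => excursionSet ρ (2 * t) K := by
      rintro K L hKL ω ⟨n, hn, hnK, h⟩
      exact ⟨n, hn, hnK.trans hKL, h⟩
    -- The bound does not depend on K, so it survives the increasing union over all window lengths.
    rw [hmono.measure_iUnion]
    refine iSup_le fun K => (measure_mono (hmono K.le_succ)).trans ?_
    exact measure_excursionSet_le hμ t.cast_nonneg (h1 t t.cast_nonneg) K.succ_pos
  have h3 : Tendsto (fun t : ℕ => 9 * p t) atTop (𝓝 0) := by
    simpa using ENNReal.Tendsto.const_mul (hp0.comp tendsto_natCast_atTop_atTop)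
      (Or.inr (by simp : (9 : ENNReal) ≠ ⊤))
  have h4 : μ (⋂ t : ℕ, ⋃ K : ℕ, excursionSet ρ (2 * t) K) = 0 :=
    le_antisymm (ge_of_tendsto' h3 fun t => (measure_mono (iInter_subset _ t)).trans (h2 t)) zero_le
  rw [← compl_mem_ae_iff] at h4
  filter_upwards [h4] with ω hω
  simp only [compl_iInter, compl_iUnion, mem_iUnion, mem_iInter, mem_compl_iff] at hω
  obtain ⟨t, ht⟩ := hω
  refine ⟨2 * t, fun n => ?_⟩
  rcases Nat.eq_zero_or_pos n with rfl | hn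
  · simp [sojourn]
  · by_contra! h
    exact ht n ⟨n, hn, le_rfl, h⟩

/-! ### The antiderivative and its phase -/

theorem exists_isCovariantAntiderivative {μ : Measure (AtomicConfig ℝ)} [IsProbabilityMeasure μ]
    (hμ : IsTranslationInvariant μ) {ρ : ℝ} (htight : IsTightFamily μ (centredCharge ρ)) :
    ∃ E : AtomicConfig ℝ → ℝ, IsCovariantAntiderivative shift μ (centredCharge ρ) E := by
  refine ⟨fun ω => -medianHeight ρ ω, (measurable_medianHeight ρ).neg, ?_⟩
  filter_upwards [ae_exists_sojourn_le hμ htight] with ω ⟨t, ht⟩ a b hab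
  have h1 := nonempty_halfLevels ht
  have h2 := bddBelow_halfLevels ht
  rw [medianHeight_shift h1 h2, medianHeight_shift h1 h2, ← height_sub_height ρ ω hab.le]
  ring

theorem exists_int_total_Ioc {ω : AtomicConfig ℝ} {e : ℝ}
    (h : ∀ x, ∃ n : ℤ, ω.charge x = n * e) (a b : ℝ) : ∃ n : ℤ, ω.total (Ioc a b) = n * e :=
  finsum_mem_induction (fun r : ℝ => ∃ n : ℤ, r = n * e) ⟨0, by simp⟩
    (fun _ _ ⟨m, hm⟩ ⟨n, hn⟩ => ⟨m + n, by rw [hm, hn]; push_cast; ring⟩) fun x _ => h x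

/-- The field F is kept abstract so that the result serves both charge processes and the pullback
from point processes. -/
theorem isCyclicFunction_phase {Ω : Type*} [MeasurableSpace Ω] {T : ℝ → Ω → Ω} {μ : Measure Ω}
    {F : Ω → ℝ → ℝ → ℝ} {e ρ : ℝ} (he : e ≠ 0) (hT : ∀ ω, T 0 ω = ω)
    (hF : ∀ᵐ ω ∂μ, ∀ a b : ℝ, a < b → ∃ n : ℤ, F ω a b = n * e - ρ * (b - a))
    {E : Ω → ℝ} (hE : IsCovariantAntiderivative T μ F E) :
    IsCyclicFunction T μ (e / ρ) (phase e E) := by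
  have hang : ∀ ω, (phase e E ω : Real.Angle) = ((2 * Real.pi * E ω / e : ℝ) : Real.Angle) := by
    intro ω
    rw [phase, Real.Angle.angle_eq_iff_two_pi_dvd_sub]
    refine ⟨-toIcoDiv Real.two_pi_pos 0 (2 * Real.pi * E ω / e), ?_⟩
    rw [toIcoMod, zsmul_eq_mul]
    push_cast
    ring
  refine ⟨?_, fun ω => ?_, ?_⟩
  · have h : phase e E = fun ω => 2 * Real.pi * E ω / e -
        ⌊(2 * Real.pi * E ω / e) / (2 * Real.pi)⌋ * (2 * Real.pi) := by
      ext ω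
      rw [phase, toIcoMod, toIcoDiv_eq_floor, zsmul_eq_mul, sub_zero]
    rw [h]
    have h1 : Measurable fun ω => 2 * Real.pi * E ω / e := (hE.1.const_mul _).div_const _
    exact h1.sub ((measurable_from_top.comp (h1.div_const _).floor).mul_const _)
  · have := toIcoMod_mem_Ico Real.two_pi_pos 0 (2 * Real.pi * E ω / e)
    rwa [zero_add] at this
  · filter_upwards [hF, hE.2] with ω hω hEω x
    have key : ∃ k : ℤ, E (T x ω) - E ω = k * e - ρ * x := by
      rcases lt_trichotomy x 0 with hx | rfl | hx
      · obtain ⟨k, hk⟩ := hω x 0 hx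
        rw [hEω x 0 hx, hT] at hk
        exact ⟨-k, by push_cast; linarith⟩
      · exact ⟨0, by simp [hT]⟩
      · obtain ⟨k, hk⟩ := hω 0 x hx
        rw [hEω 0 x hx, hT] at hk
        exact ⟨k, by linarith⟩
    obtain ⟨k, hk⟩ := key
    rw [hang, Real.Angle.coe_sub, hang, ← Real.Angle.coe_sub,
      Real.Angle.angle_eq_iff_two_pi_dvd_sub]
    refine ⟨k, ?_⟩
    rw [show E (T x ω) = E ω + (k * e - ρ * x) by linarith]
    field_simp
    ring

theorem ae_exists_int_centredCharge {μ : Measure (AtomicConfig ℝ)} {e : ℝ} (ρ : ℝ)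
    (hcharge : ∀ᵐ ω ∂μ, ∀ x : ℝ, ∃ n : ℤ, ω.charge x = n * e) :
    ∀ᵐ ω ∂μ, ∀ a b : ℝ, a < b → ∃ n : ℤ, centredCharge ρ ω a b = n * e - ρ * (b - a) := by
  filter_upwards [hcharge] with ω hω a b _
  exact (exists_int_total_Ioc hω a b).imp fun n hn => by rw [centredCharge, hn]

theorem hasCyclicFactor_of_isTightFamily {μ : Measure (AtomicConfig ℝ)} [IsProbabilityMeasure μ]
    (hμ : IsTranslationInvariant μ) {e ρ : ℝ} (he : e ≠ 0)
    (hcharge : ∀ᵐ ω ∂μ, ∀ x : ℝ, ∃ n : ℤ, ω.charge x = n * e) (hρ : ρ ≠ 0)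
    (htight : IsTightFamily μ (centredCharge ρ)) : HasCyclicFactor shift μ |e / ρ| := by
  obtain ⟨E, hE⟩ := exists_isCovariantAntiderivative hμ htight
  refine ⟨abs_pos.2 (div_ne_zero he hρ), ?_⟩
  rcases abs_choice (e / ρ) with h | h
  · exact ⟨_, h ▸ isCyclicFunction_phase he shift_zero
      (ae_exists_int_centredCharge ρ hcharge) hE⟩
  -- For e/ρ < 0 the charges are equally multiples of −e, and this reverses the rotation.
  · refine ⟨phase (-e) E, ?_⟩
    rw [h, ← neg_div]
    refine isCyclicFunction_phase (neg_ne_zero.2 he) shift_zero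
      (ae_exists_int_centredCharge ρ ?_) hE
    filter_upwards [hcharge] with ω hω x
    obtain ⟨n, hn⟩ := hω x
    exact ⟨-n, by rw [hn]; push_cast; ring⟩

end AtomicConfig

/-! ### Intensity and tightness for point processes -/

/-- Monotone additive functions on the half-line are linear. -/
theorem eq_mul_of_monotoneOn_of_additive {f : ℝ → ℝ} (hmono : MonotoneOn f (Ici 0))
    (hadd : ∀ x y, 0 ≤ x → 0 ≤ y → f (x + y) = f x + f y) {x : ℝ} (hx : 0 ≤ x) :
    f x = f 1 * x := by
  have h0 : f 0 = 0 := by simpa using hadd 0 0 le_rfl le_rfl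
  have hnat : ∀ y, 0 ≤ y → ∀ n : ℕ, f (n * y) = n * f y := by
    intro y hy n
    induction n with
    | zero => simp [h0]
    | succ n ih =>
      push_cast
      rw [add_mul, one_mul, hadd _ _ (by positivity) hy, ih]
      ring
  have h1 : 0 ≤ f 1 := h0 ▸ hmono (mem_Ici.2 le_rfl) (mem_Ici.2 zero_le_one) zero_le_one
  -- Sandwiching nx between consecutive integers gives an error at most f 1 independent of n; the
  -- Archimedean property then forces equality.
  have hbound : ∀ n : ℕ, (n : ℝ) * |f x - f 1 * x| ≤ f 1 := by
    intro n
    have hnx : 0 ≤ (n : ℝ) * x := by positivity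
    have hl := hmono (mem_Ici.2 (Nat.cast_nonneg ⌊(n : ℝ) * x⌋₊)) (mem_Ici.2 hnx)
      (Nat.floor_le hnx)
    have hu := hmono (mem_Ici.2 hnx)
      (mem_Ici.2 (by positivity : (0 : ℝ) ≤ (⌊(n : ℝ) * x⌋₊ + 1 : ℕ)))
      (by push_cast; exact (Nat.lt_floor_add_one _).le)
    have e1 := hnat 1 zero_le_one ⌊(n : ℝ) * x⌋₊
    have e2 := hnat 1 zero_le_one (⌊(n : ℝ) * x⌋₊ + 1)
    rw [mul_one] at e1 e2
    rw [e1, hnat x hx] at hl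
    rw [e2, hnat x hx] at hu
    push_cast at hu
    have h2 := mul_le_mul_of_nonneg_right (Nat.floor_le hnx) h1
    have h3 := mul_le_mul_of_nonneg_right (Nat.lt_floor_add_one ((n : ℝ) * x)).le h1
    rw [← abs_of_nonneg (Nat.cast_nonneg n : (0 : ℝ) ≤ n), ← abs_mul, abs_le]
    constructor <;> nlinarith
  by_contra hne
  have hpos : 0 < |f x - f 1 * x| := abs_pos.2 (sub_ne_zero.2 hne)
  obtain ⟨n, hn⟩ := exists_nat_gt (f 1 / |f x - f 1 * x|)
  rw [div_lt_iff₀ hpos] at hn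
  exact absurd (hbound n) (not_le.2 hn)

namespace AtomicConfig

/-- A particle configuration as a configuration of unit charges. -/
noncomputable def toCharges (ω : AtomicConfig ℕ) : AtomicConfig ℝ where
  charge x := ω.charge x
  finite_atoms a b := by simpa using ω.finite_atoms a b

theorem total_toCharges (ω : AtomicConfig ℕ) (a b : ℝ) :
    ω.toCharges.total (Ioc a b) = ω.total (Ioc a b) :=
  ((Nat.castAddMonoidHom ℝ).map_finsum_mem' (ω.finite_support_Ioc a b)).symm

theorem measurable_toCharges : Measurable toCharges := by
  refine measurable_of_total_Ioc fun a b => ?_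
  simp only [total_toCharges]
  exact measurable_from_top.comp (measurable_total_Ioc a b)

theorem measurable_shift {R : Type} [AddCommMonoid R] [MeasurableSpace R] (x : ℝ) :
    Measurable (shift x : AtomicConfig R → AtomicConfig R) := by
  refine measurable_of_total_Ioc fun a b => ?_
  simp only [total_shift]
  exact measurable_total_Ioc _ _

theorem isTranslationInvariant_map_toCharges {μ : Measure (AtomicConfig ℕ)}
    (hμ : IsTranslationInvariant μ) : IsTranslationInvariant (μ.map toCharges) := by
  refine fun x => ⟨measurable_shift x, ?_⟩
  rw [Measure.map_map (measurable_shift x) measurable_toCharges,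
    show shift x ∘ toCharges = toCharges ∘ shift x from rfl,
    ← Measure.map_map measurable_toCharges (measurable_shift x), (hμ x).map_eq]

theorem measurable_centredCharge (ρ a b : ℝ) : Measurable fun ω => centredCharge ρ ω a b :=
  (measurable_total_Ioc a b).sub_const _

theorem total_mono (ω : AtomicConfig ℕ) {S : Set ℝ} {a b : ℝ} (h : S ⊆ Icc a b) {T : Set ℝ}
    (hT : T ⊆ S) : ω.total T ≤ ω.total S := by
  have hfin : (S ∩ Function.support ω.charge).Finite :=
    (ω.finite_atoms a b).subset fun x hx => ⟨h hx.1, hx.2⟩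
  unfold total
  rw [← inter_union_sdiff S T, inter_eq_self_of_subset_right hT,
    finsum_mem_union' disjoint_sdiff_right (hfin.subset (inter_subset_inter_left _ hT))
      (hfin.subset (inter_subset_inter_left _ sdiff_subset))]
  exact Nat.le_add_right _ _

section Intensity

variable {μ : Measure (AtomicConfig ℕ)}

theorem integral_total_Ioc_shift (hμ : IsTranslationInvariant μ) (a b x : ℝ) :
    ∫ ω, (ω.total (Ioc (a + x) (b + x)) : ℝ) ∂μ = ∫ ω, (ω.total (Ioc a b) : ℝ) ∂μ := by
  have hm : Measurable fun ω : AtomicConfig ℕ => (ω.total (Ioc a b) : ℝ) :=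
    measurable_from_top.comp (measurable_total_Ioc a b)
  have h : ∫ ω, (ω.total (Ioc a b) : ℝ) ∂(μ.map (shift x)) =
      ∫ ω, ((shift x ω).total (Ioc a b) : ℝ) ∂μ :=
    integral_map (measurable_shift x).aemeasurable hm.aestronglyMeasurable
  rw [(hμ x).map_eq] at h
  simpa only [total_shift] using h.symm

theorem integral_total_Ioc (hμ : IsTranslationInvariant μ)
    (hint : ∀ a b : ℝ, a < b → Integrable (fun ω : AtomicConfig ℕ => (ω.total (Ioc a b) : ℝ)) μ)
    {a b : ℝ} (hab : a ≤ b) :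
    ∫ ω, (ω.total (Ioc a b) : ℝ) ∂μ = (∫ ω, (ω.total (Ioc 0 1) : ℝ) ∂μ) * (b - a) := by
  have hint' : ∀ a b : ℝ, Integrable (fun ω : AtomicConfig ℕ => (ω.total (Ioc a b) : ℝ)) μ := by
    intro a b
    rcases lt_or_ge a b with h | h
    · exact hint a b h
    · simp [total_Ioc_eq_zero _ h]
  have hadd : ∀ x y : ℝ, 0 ≤ x → 0 ≤ y → ∫ ω, (ω.total (Ioc 0 (x + y)) : ℝ) ∂μ =
      ∫ ω, (ω.total (Ioc 0 x) : ℝ) ∂μ + ∫ ω, (ω.total (Ioc 0 y) : ℝ) ∂μ := by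
    intro x y hx hy
    rw [← integral_total_Ioc_shift hμ 0 y x, ← integral_add (hint' _ _) (hint' _ _)]
    refine integral_congr_ae (Eventually.of_forall fun ω => ?_)
    simp only
    rw [zero_add, add_comm y x, ← Nat.cast_add, ω.total_Ioc_add hx (by linarith)]
  have hlin := eq_mul_of_monotoneOn_of_additive
    (f := fun x => ∫ ω, (ω.total (Ioc 0 x) : ℝ) ∂μ) (fun x _ y _ hxy => integral_mono (hint' _ _)
      (hint' _ _) fun ω => Nat.cast_le.2 (ω.total_mono Ioc_subset_Icc_self
        (Ioc_subset_Ioc_right hxy))) hadd (sub_nonneg.2 hab)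
  rw [← hlin, ← integral_total_Ioc_shift hμ 0 (b - a) a, zero_add, sub_add_cancel]

/-- The closed interval lies in (−1/(n+1), 1], whose mean tends to that of (0, 1]; thus the endpoint
contributes nothing. -/
theorem integral_total_Icc (hμ : IsTranslationInvariant μ)
    (hint : ∀ a b : ℝ, a < b → Integrable (fun ω : AtomicConfig ℕ => (ω.total (Ioc a b) : ℝ)) μ)
    (h : Integrable (fun ω : AtomicConfig ℕ => (ω.total (Icc 0 1) : ℝ)) μ) :
    ∫ ω, (ω.total (Icc 0 1) : ℝ) ∂μ = ∫ ω, (ω.total (Ioc 0 1) : ℝ) ∂μ := by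
  refine le_antisymm ?_ (integral_mono (hint 0 1 one_pos) h fun ω => Nat.cast_le.2
    (ω.total_mono subset_rfl Ioc_subset_Icc_self))
  have hlim : Tendsto (fun n : ℕ => (∫ ω, (ω.total (Ioc 0 1) : ℝ) ∂μ) *
      (1 - -(1 / ((n : ℝ) + 1)))) atTop (𝓝 (∫ ω, (ω.total (Ioc 0 1) : ℝ) ∂μ)) := by
    simpa using ((tendsto_one_div_add_atTop_nhds_zero_nat (𝕜 := ℝ)).neg.const_sub 1).const_mul
      (∫ ω, (ω.total (Ioc 0 1) : ℝ) ∂μ)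
  refine ge_of_tendsto' hlim fun n => ?_
  have hn : 0 < 1 / ((n : ℝ) + 1) := by positivity
  rw [← integral_total_Ioc hμ hint (by linarith)]
  exact integral_mono h (hint _ _ (by linarith)) fun ω => Nat.cast_le.2
    (ω.total_mono Ioc_subset_Icc_self fun x hx => ⟨by linarith [hx.1], hx.2⟩)

theorem isTightFamily_map_toCharges [IsProbabilityMeasure μ] {ρ C : ℝ}
    (hmem : ∀ a b : ℝ, a < b → MemLp (fun ω : AtomicConfig ℕ => (ω.total (Ioc a b) : ℝ)) 2 μ)
    (hvar : ∀ a b : ℝ, a < b → variance (fun ω : AtomicConfig ℕ => (ω.total (Ioc a b) : ℝ)) μ ≤ C)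
    (hmean : ∀ a b : ℝ, a < b → ∫ ω, (ω.total (Ioc a b) : ℝ) ∂μ = ρ * (b - a)) :
    IsTightFamily (μ.map toCharges) (centredCharge ρ) := by
  have hC : 0 ≤ C := (variance_nonneg _ _).trans (hvar 0 1 one_pos)
  -- Chebyshev's bound for t > 0; the value ⊤ elsewhere keeps the function nonincreasing.
  refine ⟨fun t => if 0 < t then ENNReal.ofReal (C / t ^ 2) else ⊤, ?_, ?_, ?_⟩
  · intro s t hst
    by_cases hs : 0 < s
    · simp only [hs, hs.trans_le hst, if_true]
      gcongr
    · simp [hs]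
  · have h : Tendsto (fun t : ℝ => ENNReal.ofReal (C / t ^ 2)) atTop (𝓝 0) := by
      rw [← ENNReal.ofReal_zero]
      exact ENNReal.tendsto_ofReal
        (tendsto_const_nhds.div_atTop (tendsto_pow_atTop two_ne_zero))
    refine h.congr' ?_
    filter_upwards [eventually_gt_atTop 0] with t ht
    rw [if_pos ht]
  · intro a b hab t
    dsimp only
    by_cases ht : 0 < t
    · rw [if_pos ht, Measure.map_apply measurable_toCharges
        (measurableSet_le measurable_const (measurable_centredCharge ρ a b).abs)]
      have h := meas_ge_le_variance_div_sq (hmem a b hab) ht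
      rw [hmean a b hab] at h
      refine (measure_mono fun ω hω => ?_).trans (h.trans (ENNReal.ofReal_le_ofReal ?_))
      · simpa [centredCharge, total_toCharges] using hω
      · gcongr
        exact hvar a b hab
    · simp [ht]

end Intensity

theorem hasCyclicFactor_of_variance_le {μ : Measure (AtomicConfig ℕ)} [IsProbabilityMeasure μ]
    (hμ : IsTranslationInvariant μ) (hpos : 0 < ∫ ω, (ω.total (Icc 0 1) : ℝ) ∂μ) {C : ℝ}
    (hmem : ∀ a b : ℝ, a < b → MemLp (fun ω : AtomicConfig ℕ => (ω.total (Ioc a b) : ℝ)) 2 μ)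
    (hvar : ∀ a b : ℝ, a < b →
      variance (fun ω : AtomicConfig ℕ => (ω.total (Ioc a b) : ℝ)) μ ≤ C) :
    HasCyclicFactor shift μ (1 / ∫ ω, (ω.total (Icc 0 1) : ℝ) ∂μ) := by
  have hint : ∀ a b : ℝ, a < b →
      Integrable (fun ω : AtomicConfig ℕ => (ω.total (Ioc a b) : ℝ)) μ :=
    fun a b hab => (hmem a b hab).integrable one_le_two
  -- An undefined Bochner integral would be 0, so positivity already yields integrability.
  have hIcc := integral_total_Icc hμ hint (not_imp_comm.1 integral_undef hpos.ne')
  refine ⟨one_div_pos.2 hpos, ?_⟩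
  set ρ := ∫ ω, (ω.total (Icc 0 1) : ℝ) ∂μ with hρ
  have : IsProbabilityMeasure (μ.map toCharges) :=
    Measure.isProbabilityMeasure_map measurable_toCharges.aemeasurable
  obtain ⟨E, hE⟩ := exists_isCovariantAntiderivative (isTranslationInvariant_map_toCharges hμ)
    (isTightFamily_map_toCharges (ρ := ρ) hmem hvar fun a b hab => by
      rw [integral_total_Ioc hμ hint hab.le, hIcc])
  have hE' : IsCovariantAntiderivative shift μ (fun ω => centredCharge ρ ω.toCharges)
      (E ∘ toCharges) :=
    ⟨hE.1.comp measurable_toCharges, ae_of_ae_map measurable_toCharges.aemeasurable hE.2⟩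
  have hF : ∀ᵐ ω ∂μ, ∀ a b : ℝ, a < b →
      ∃ n : ℤ, centredCharge ρ ω.toCharges a b = n * 1 - ρ * (b - a) :=
    Eventually.of_forall fun ω a b _ =>
      ⟨ω.total (Ioc a b), by simp [centredCharge, total_toCharges]⟩
  exact ⟨_, isCyclicFunction_phase one_ne_zero shift_zero hF hE'⟩

end AtomicConfig

theorem theorem1 :
    -- point processes with uniformly bounded number variance
    (∀ (μ : Measure (AtomicConfig ℕ)) [IsProbabilityMeasure μ],
      IsTranslationInvariant μ →
      -- the process is not almost surely empty
      0 < ∫ ω, (ω.total (Icc 0 1) : ℝ) ∂μ →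
      (∃ C : ℝ, ∀ a b : ℝ, a < b →
        MemLp (fun ω : AtomicConfig ℕ => (ω.total (Ioc a b) : ℝ)) 2 μ ∧
          variance (fun ω : AtomicConfig ℕ => (ω.total (Ioc a b) : ℝ)) μ ≤ C) →
      HasCyclicFactor AtomicConfig.shift μ (1 / ∫ ω, (ω.total (Icc 0 1) : ℝ) ∂μ)) ∧
    -- point-charge processes with charges in `e ℤ` and tight centred charges
    (∀ (μ : Measure (AtomicConfig ℝ)) [IsProbabilityMeasure μ] (e ρ : ℝ),
      IsTranslationInvariant μ →
      e ≠ 0 →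
      (∀ᵐ ω ∂μ, ∀ x : ℝ, ∃ n : ℤ, ω.charge x = n * e) →
      ρ ≠ 0 →
      IsTightFamily μ (centredCharge ρ) →
      HasCyclicFactor AtomicConfig.shift μ |e / ρ| ∧
      (∃ E : AtomicConfig ℝ → ℝ,
        IsCovariantAntiderivative AtomicConfig.shift μ (centredCharge ρ) E) ∧
      ∀ E : AtomicConfig ℝ → ℝ,
        IsCovariantAntiderivative AtomicConfig.shift μ (centredCharge ρ) E →
        IsCyclicFunction AtomicConfig.shift μ (e / ρ) (phase e E)) := by
  refine ⟨fun μ _ hμ hpos ⟨C, hC⟩ => ?_, fun μ _ e ρ hμ he hcharge hρ htight => ⟨?_, ?_, ?_⟩⟩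
  · exact AtomicConfig.hasCyclicFactor_of_variance_le hμ hpos (fun a b hab => (hC a b hab).1)
      fun a b hab => (hC a b hab).2
  · exact AtomicConfig.hasCyclicFactor_of_isTightFamily hμ he hcharge hρ htight
  · exact AtomicConfig.exists_isCovariantAntiderivative hμ htight
  · exact fun E hE => AtomicConfig.isCyclicFunction_phase he AtomicConfig.shift_zero
      (AtomicConfig.ae_exists_int_centredCharge ρ hcharge) hE
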